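/- For a permutation $\sigma=a_1\cdots a_n$ of $\{1,\dots,n\}$ let $\mathrm{inv}\,\sigma$ be the number of pairs $i<j$ with $a_i>a_j$, let $\mathrm{lrm}\,\sigma$ be the number of left-right maxima of $\sigma$ (the $a_i$ with $a_i=\max\{a_1,\dots,a_i\}$), and let $\mathrm{fix}\,\sigma$ be the number of fixed points of $\sigma$. Let $\mathrm{Av}_n(321)$ be the set of permutations of $\{1,\dots,n\}$ that contain no $i<j<k$ with $a_i>a_j>a_k$. Put $$\mathfrak I(q,t,x;z)=\sum_{n\ge 0} z^n\sum_{\sigma\in \mathrm{Av}_n(321)} q^{\mathrm{inv}\,\sigma}\,t^{\mathrm{lrm}\,\sigma}\,x^{\mathrm{fix}\,\sigma}.$$ **Theorem.** Let $q,t,x$ be indeterminates or, more generally, elements of any commutative ring $R$. Then $\mathfrak I(q,t,x;z)\in R[[z]]$ has the Jacobi-type continued fraction expansion $$\mathfrak I(q,t,x;z)=\cfrac{1}{1-b_0z-\cfrac{\lambda_1z^2}{1-b_1z-\cfrac{\lambda_2z^2}{1-b_2z-\cdots}}},\qquad b_0=tx,\quad b_h=(1+t)q^h,\quad \lambda_h=t\,q^{2h-1}\quad(h\ge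 1),$$ that is, for each $m$ the coefficient of $z^m$ in the $n$-th convergent (the fraction cut off after $n$ partial quotients) equals the coefficient of $z^m$ in $\mathfrak I(q,t,x;z)$ for all sufficiently large $n$. -/

import Mathlib

namespace PermStat

/-- A permutation `σ` of `n` letters contains the pattern `π` if some subsequence of
`σ(1) … σ(n)` is in the same relative order as `π(1) … π(k)`. -/
def Contains {k n : ℕ} (π : Equiv.Perm (Fin k)) (σ : Equiv.Perm (Fin n)) : Prop :=
  ∃ f : Fin k ↪o Fin n, ∀ i j : Fin k, σ (f i) < σ (f j) ↔ π i < π j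

/-- The pattern `321`, that is, the order-reversing permutation of three letters. -/
def pattern321 : Equiv.Perm (Fin 3) := Fin.revPerm

open Classical in
/-- `Av n π` is the set of permutations of `n` letters that avoid `π`. -/
noncomputable def Av {k : ℕ} (n : ℕ) (π : Equiv.Perm (Fin k)) : Finset (Equiv.Perm (Fin n)) :=
  Finset.univ.filter fun σ => ¬ Contains π σ

/-- The number of inversions. -/
def inv {n : ℕ} (σ : Equiv.Perm (Fin n)) : ℕ :=
  (Finset.univ.filter fun p : Fin n × Fin n => p.1 < p.2 ∧ σ p.2 < σ p.1).card

/-- The set of left-right maxima (values): the `σ i` with `σ i = max {σ j | j ≤ i}`. -/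
def Lrm {n : ℕ} (σ : Equiv.Perm (Fin n)) : Finset (Fin n) :=
  (Finset.univ.filter fun i => ∀ j, j ≤ i → σ j ≤ σ i).image σ

/-- The number of left-right maxima. -/
def lrm {n : ℕ} (σ : Equiv.Perm (Fin n)) : ℕ := (Lrm σ).card

/-- The number of fixed points. -/
def fix {n : ℕ} (σ : Equiv.Perm (Fin n)) : ℕ :=
  (Finset.univ.filter fun i => σ i = i).card

/-- `I_n(q,t,x) = ∑_{σ ∈ Av_n(321)} q^{inv σ} t^{lrm σ} x^{fix σ}`. -/
noncomputable def I {R : Type*} [CommRing R] (q t x : R) (n : ℕ) : R :=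
  ∑ σ ∈ Av n pattern321, q ^ inv σ * t ^ lrm σ * x ^ fix σ

/-- The generating function `∑_{n ≥ 0} I_n(q,t,x) z^n`, with `z` the power series variable. -/
noncomputable def genFun {R : Type*} [CommRing R] (q t x : R) : PowerSeries R :=
  PowerSeries.mk fun n => I q t x n

end PermStat

namespace JFraction

open PowerSeries

/-- `convergent b lam n h` is the fraction
`1 / (1 - b_h z - lam_{h+1} z² / (1 - b_{h+1} z - lam_{h+2} z² / (⋯)))`
truncated after `n` partial quotients. For `h = 0` it is the `n`th convergent of the
Jacobi-type continued fraction with coefficients `b` and `lam` (the value `lam 0` is not used).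
All denominators have constant term `1`, hence are units; see `denominator_mul_convergent`. -/
noncomputable def convergent {R : Type*} [CommRing R] (b lam : ℕ → R) : ℕ → ℕ → PowerSeries R
  | 0, _ => 0
  | n + 1, h =>
      Ring.inverse (1 - C (b h) * X - C (lam (h + 1)) * X ^ 2 * convergent b lam n (h + 1))

theorem denominator_mul_convergent {R : Type*} [CommRing R] (b lam : ℕ → R) (n h : ℕ) :
    (1 - C (b h) * X - C (lam (h + 1)) * X ^ 2 * convergent b lam n (h + 1)) *
      convergent b lam (n + 1) h = 1 := by
  rw [convergent]
  apply Ring.mul_inverse_cancel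
  rw [PowerSeries.isUnit_iff_constantCoeff]
  simp

/-- `F` is the value of the (infinite) Jacobi-type continued fraction with coefficients `b` and
`lam`: the convergents tend to `F` as formal power series, that is, each coefficient of the
convergents is eventually equal to that of `F`. -/
def HasExpansion {R : Type*} [CommRing R] (F : PowerSeries R) (b lam : ℕ → R) : Prop :=
  ∀ m : ℕ, ∀ᶠ n in Filter.atTop, coeff m (convergent b lam n 0) = coeff m F

end JFraction

/-!
Encode a permutation `σ` of `{0, …, n - 1}` by the word whose `k`-th letter records whether `k` is
the position of a weak excedance (`k ≤ σ k`) and whether it is the value of one (`σ⁻¹ k ≤ k`).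
Read as up, down and two kinds of level steps, this word is a Motzkin path from height `0` to
height `0`, whose height before step `k` is the number of `i < k` with `k ≤ σ i` (`height_succ`).

On `321`-avoiding permutations all three statistics can be read off the path. The left-right
maxima are the weak excedances (`isLrm_iff`), so `lrm` counts the up steps and one kind of level
step. The larger entry of each inversion is a left-right maximum, and a left-right maximum `σ i` is
the larger entry of exactly `σ i - i` inversions, so `inv` is the sum of the heights (`inv_eq`).
A fixed point must split the permutation, so `fix` counts the corresponding level steps at height
`0` (`fix_eq`). The other kind of level step does not occur at height `0`.

A `321`-avoiding permutation is increasing on its weak excedances and on the other positions, so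
the word determines it (`word_injOn`). Conversely, given a path of nonzero weight, the permutation
that maps the marked positions increasingly to the marked values, and likewise the unmarked ones,
avoids `321` and has that path (`exists_word_eq`). Hence the generating function enumerates
weighted Motzkin paths (`I_eq_pathSum`).

For weighted Motzkin paths, let `M h` be the generating function of the paths from height `h` to
`0`. The first-step recursion gives, by induction on `k`, that `M (h + 1)` agrees modulo `X ^ k`
with `M h` times the weight of a down step times `X` times the `k`-th convergent of the fraction
started at `h + 1` (`X_pow_dvd_sub_convergent`). Inserting this for `h = 0` into the recursion for
`M 0` gives the expansion (`hasExpansion_of_firstStep`).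
-/

/-! ### Continued fractions and first-step recursions -/

namespace JFraction

open PowerSeries

/-- A path from height `h + 1` to `0` splits at its first step down to height `h`. The part before
that step stays at height at least `h + 1`, and is enumerated by the continued fraction started at
`h + 1`. -/
theorem X_pow_dvd_sub_convergent {R : Type*} [CommRing R] (b u d : ℕ → R) (M : ℕ → PowerSeries R)
    (hM : ∀ h, M (h + 1) = C (b (h + 1)) * X * M (h + 1) + C (u (h + 1)) * X * M (h + 2)
      + C (d (h + 1)) * X * M h) (k h : ℕ) :
    (X : PowerSeries R) ^ k ∣
      M (h + 1) - C (d (h + 1)) * X * convergent b (fun h => u (h - 1) * d h) k (h + 1) * M h := by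
  induction k generalizing h with
  | zero => simp
  | succ k ih =>
    obtain ⟨E, hE⟩ := ih (h + 1)
    have hden := denominator_mul_convergent b (fun h => u (h - 1) * d h) k (h + 1)
    simp only [add_tsub_cancel_right, map_mul] at hden
    set K := convergent b (fun h => u (h - 1) * d h) (k + 1) (h + 1)
    refine ⟨C (u (h + 1)) * E * K, ?_⟩
    linear_combination K * hM h + C (u (h + 1)) * X * K * hE - M (h + 1) * hden

/-- If `M h` enumerates lattice paths from height `h` to height `0` by their first step, with
weights `b h` for level steps, `u h` for up steps and `d h` for down steps from height `h`, then
`M 0` has a Jacobi-type continued fraction expansion. -/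
theorem hasExpansion_of_firstStep {R : Type*} [CommRing R] (b u d lam : ℕ → R)
    (M : ℕ → PowerSeries R) (hlam : ∀ h, lam (h + 1) = u h * d (h + 1))
    (h0 : M 0 = 1 + C (b 0) * X * M 0 + C (u 0) * X * M 1)
    (hM : ∀ h, M (h + 1) = C (b (h + 1)) * X * M (h + 1) + C (u (h + 1)) * X * M (h + 2)
      + C (d (h + 1)) * X * M h) :
    HasExpansion (M 0) b lam := by
  -- `lam` may be replaced by a sequence given by `u` and `d`, as `lam 0` plays no role.
  have hconv : ∀ k h, convergent b lam k h = convergent b (fun h => u (h - 1) * d h) k h := by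
    intro k
    induction k with
    | zero => intro h; rfl
    | succ k ih => intro h; simp only [convergent, ih, hlam, add_tsub_cancel_right]
  intro m
  filter_upwards [Filter.eventually_gt_atTop (m + 1)] with n hn
  obtain ⟨k, rfl⟩ : ∃ k, n = k + 1 := ⟨n - 1, by omega⟩
  rw [hconv]
  obtain ⟨E, hE⟩ := X_pow_dvd_sub_convergent b u d M hM k 0
  have hden := denominator_mul_convergent b (fun h => u (h - 1) * d h) k 0
  simp only [map_mul, zero_add] at hden hE
  set K := convergent b (fun h => u (h - 1) * d h) (k + 1) 0
  have key : M 0 - K = X ^ k * (X * C (u 0) * E * K) := by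
    linear_combination K * h0 + C (u 0) * X * K * hE - M 0 * hden
  have hc := congrArg (coeff m) key
  rw [coeff_X_pow_mul', if_neg (by omega), map_sub, sub_eq_zero] at hc
  exact hc.symm

end JFraction

/-! ### Weighted Motzkin paths -/

namespace PermStat

/-- The height reached from height `h` by the step `a`: the first entry of a letter says whether
the path gains a unit, the second whether it loses one, so that `(true, false)` is an up step,
`(false, true)` a down step, and the other two letters are the two kinds of level steps. -/
def nextHeight (h : ℕ) (a : Bool × Bool) : ℕ := h + a.1.toNat - a.2.toNat

/-- The weight of the step `a` at height `h`. At height `0` the steps that do not gain a unit are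
forbidden: they get weight `0`. -/
def stepWeight {R : Type*} [CommRing R] (q t x : R) (h : ℕ) (a : Bool × Bool) : R :=
  if a.1 = false ∧ h = 0 then 0
  else q ^ nextHeight h a * (if a.1 then t else 1) * (if a = (true, true) ∧ h = 0 then x else 1)

/-- The weight of the path that starts at height `h` and follows the word `w`: the product of the
weights of its steps if the path ends at height `0`, and `0` otherwise. -/
def pathWeight {R : Type*} [CommRing R] (q t x : R) :
    (n : ℕ) → ℕ → (Fin n → Bool × Bool) → R
  | 0, h, _ => if h = 0 then 1 else 0
  | n + 1, h, w => stepWeight q t x h (w 0) * pathWeight q t x n (nextHeight h (w 0)) (Fin.tail w)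

/-- The weight of a path whose heights are given by `c`. -/
theorem pathWeight_eq_prod {R : Type*} [CommRing R] (q t x : R) (n : ℕ) (c : ℕ → ℕ)
    (w : Fin n → Bool × Bool) (hc : ∀ k : Fin n, c (k + 1) = nextHeight (c k) (w k)) :
    pathWeight q t x n (c 0) w =
      (∏ k : Fin n, stepWeight q t x (c k) (w k)) * if c n = 0 then 1 else 0 := by
  induction n generalizing c with
  | zero => simp [pathWeight]
  | succ n ih =>
    have h0 : c 1 = nextHeight (c 0) (w 0) := hc 0
    have h1 := ih (fun k => c (k + 1)) (Fin.tail w) fun k => hc k.succ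
    rw [pathWeight, ← h0, Fin.prod_univ_succ, mul_assoc]
    simp only [zero_add] at h1
    rw [h1]
    simp [Fin.tail]

/-- The total weight of the paths of length `n` from height `h` to height `0`. -/
def pathSum {R : Type*} [CommRing R] (q t x : R) (n h : ℕ) : R :=
  ∑ w : Fin n → Bool × Bool, pathWeight q t x n h w

theorem pathSum_succ {R : Type*} [CommRing R] (q t x : R) (n h : ℕ) :
    pathSum q t x (n + 1) h =
      ∑ a : Bool × Bool, stepWeight q t x h a * pathSum q t x n (nextHeight h a) := by
  simp only [pathSum, Finset.mul_sum]
  rw [← Fintype.sum_prod_type', ← (Fin.consEquiv fun _ : Fin (n + 1) => Bool × Bool).sum_comp]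
  rfl

theorem hasExpansion_pathSum {R : Type*} [CommRing R] (q t x : R) :
    JFraction.HasExpansion (PowerSeries.mk fun n => pathSum q t x n 0)
      (fun h => if h = 0 then t * x else (1 + t) * q ^ h) (fun h => t * q ^ (2 * h - 1)) := by
  -- Up and down steps carry `q` to the height they reach; no down step starts at height `0`, so
  -- the truncation in `h - 1` does not matter.
  refine JFraction.hasExpansion_of_firstStep _ (fun h => t * q ^ (h + 1)) (fun h => q ^ (h - 1)) _
    (fun h => PowerSeries.mk fun n => pathSum q t x n h) ?_ ?_ ?_
  · intro h
    rw [show 2 * (h + 1) - 1 = (h + 1) + h by omega, pow_add]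
    simp [mul_assoc]
  · ext n
    cases n with
    | zero => simp [pathSum, pathWeight, mul_assoc]
    | succ n =>
      simp only [mul_assoc, map_add, PowerSeries.coeff_C_mul, PowerSeries.coeff_succ_X_mul,
        PowerSeries.coeff_mk, pathSum_succ, Fintype.sum_prod_type, Fintype.sum_bool]
      simp [stepWeight, nextHeight, PowerSeries.coeff_one]
      ring
  · intro h
    ext n
    cases n with
    | zero => simp [pathSum, pathWeight, mul_assoc]
    | succ n =>
      simp only [mul_assoc, map_add, PowerSeries.coeff_C_mul, PowerSeries.coeff_succ_X_mul,
        PowerSeries.coeff_mk, pathSum_succ, Fintype.sum_prod_type, Fintype.sum_bool]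
      simp [stepWeight, nextHeight]
      ring

/-! ### The path of a permutation -/

theorem mem_Av_pattern321 {n : ℕ} {σ : Equiv.Perm (Fin n)} :
    σ ∈ Av n pattern321 ↔ ∀ i j k, i < j → j < k → σ j < σ i → σ j ≤ σ k := by
  classical
  simp only [Av, Finset.mem_filter, Finset.mem_univ, true_and]
  constructor
  · intro h i j k hij hjk hji
    by_contra! hkj
    refine h ⟨OrderEmbedding.ofStrictMono ![i, j, k] ?_, ?_⟩
    · rw [Fin.strictMono_iff_lt_succ]
      intro a
      fin_cases a <;> simpa
    · have hki := hkj.trans hji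
      intro a b
      fin_cases a <;> fin_cases b <;> simp [pattern321, Fin.revPerm, *, le_of_lt]
  · rintro h ⟨f, hf⟩
    have h01 : f 0 < f 1 := f.lt_iff_lt.2 (by decide)
    have h12 : f 1 < f 2 := f.lt_iff_lt.2 (by decide)
    have h10 : σ (f 1) < σ (f 0) := (hf 1 0).2 (by decide)
    have h21 : σ (f 2) < σ (f 1) := (hf 2 1).2 (by decide)
    exact absurd (h _ _ _ h01 h12 h10) (not_le.2 h21)

/-- The number of positions before `k` (counting from `0`) whose value is at least `k`. -/
def height {n : ℕ} (σ : Equiv.Perm (Fin n)) (k : ℕ) : ℕ :=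
  (Finset.univ.filter fun i : Fin n => i.val < k ∧ k ≤ (σ i).val).card

/-- The word of a permutation: its `k`-th letter says whether `k` is the position of a weak
excedance, and whether `k` is the value of one. -/
def word {n : ℕ} (σ : Equiv.Perm (Fin n)) (k : Fin n) : Bool × Bool :=
  (decide (k ≤ σ k), decide (σ.symm k ≤ k))

theorem card_filter_apply {n : ℕ} (σ : Equiv.Perm (Fin n)) (p : Fin n → Prop) [DecidablePred p] :
    (Finset.univ.filter fun i => p (σ i)).card = (Finset.univ.filter p).card := by
  simp only [Finset.card_filter]
  exact Equiv.sum_comp σ fun i => if p i then 1 else 0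

/-- As many values jump upwards over `k` as downwards. -/
theorem height_eq_card_downward {n : ℕ} (σ : Equiv.Perm (Fin n)) (k : ℕ) :
    height σ k = (Finset.univ.filter fun i : Fin n => k ≤ i.val ∧ (σ i).val < k).card := by
  have h := card_filter_apply σ fun i => i.val < k
  simp only [height, Finset.card_filter] at h ⊢
  have h2 : ∑ i : Fin n, ((if i.val < k ∧ k ≤ (σ i).val then 1 else 0) +
        if (σ i).val < k then 1 else 0) =
      ∑ i : Fin n, ((if k ≤ i.val ∧ (σ i).val < k then 1 else 0) + if i.val < k then 1 else 0) := by
    refine Finset.sum_congr rfl fun i _ => ?_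
    split_ifs <;> omega
  rw [Finset.sum_add_distrib, Finset.sum_add_distrib] at h2
  omega

theorem exists_downward_of_upward {n : ℕ} {σ : Equiv.Perm (Fin n)} {k : ℕ} {i : Fin n}
    (h1 : i.val < k) (h2 : k ≤ (σ i).val) : ∃ j : Fin n, k ≤ j.val ∧ (σ j).val < k := by
  have h : 0 < height σ k := Finset.card_pos.2 ⟨i, by simp [h1, h2]⟩
  rw [height_eq_card_downward] at h
  obtain ⟨j, hj⟩ := Finset.card_pos.1 h
  exact ⟨j, by simpa using hj⟩

theorem height_pos_of_downward {n : ℕ} {σ : Equiv.Perm (Fin n)} {k : ℕ} {i : Fin n}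
    (h1 : k ≤ i.val) (h2 : (σ i).val < k) : 0 < height σ k := by
  rw [height_eq_card_downward]
  exact Finset.card_pos.2 ⟨i, by simp [h1, h2]⟩

theorem exists_upward_of_downward {n : ℕ} {σ : Equiv.Perm (Fin n)} {k : ℕ} {i : Fin n}
    (h1 : k ≤ i.val) (h2 : (σ i).val < k) : ∃ j : Fin n, j.val < k ∧ k ≤ (σ j).val := by
  obtain ⟨j, hj⟩ := Finset.card_pos.1 (height_pos_of_downward h1 h2)
  exact ⟨j, by simpa using hj⟩

theorem height_succ {n : ℕ} (σ : Equiv.Perm (Fin n)) (k : Fin n) :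
    height σ (k + 1) = nextHeight (height σ k) (word σ k) := by
  have h : height σ (k + 1) + (word σ k).2.toNat = height σ k + (word σ k).1.toNat := by
    have h1 : (word σ k).2.toNat = ∑ i : Fin n, if i = σ.symm k then (word σ k).2.toNat else 0 := by
      simp
    have h2 : (word σ k).1.toNat = ∑ i : Fin n, if i = k then (word σ k).1.toNat else 0 := by
      simp
    rw [h1, h2]
    simp only [height, Finset.card_filter]
    rw [← Finset.sum_add_distrib, ← Finset.sum_add_distrib]
    refine Finset.sum_congr rfl fun i _ => ?_
    have h3 : i = σ.symm k ↔ (σ i).val = k.val := by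
      rw [Equiv.eq_symm_apply, Fin.ext_iff]
    have h4 : (if i = σ.symm k then (word σ k).2.toNat else 0) =
        if (σ i).val = k.val ∧ i.val ≤ k.val then 1 else 0 := by
      by_cases hi : i = σ.symm k
      · have := h3.1 hi
        subst hi
        simp [word, Bool.toNat]
      · rw [if_neg hi, if_neg fun hh => hi (h3.2 hh.1)]
    have h5 : (if i = k then (word σ k).1.toNat else 0) =
        if i.val = k.val ∧ k.val ≤ (σ i).val then 1 else 0 := by
      by_cases hi : i = k
      · subst hi
        simp [word, Bool.toNat]
      · rw [if_neg hi, if_neg fun hh => hi (Fin.ext hh.1)]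
    rw [h4, h5]
    split_ifs <;> omega
  simp only [nextHeight]
  omega

/-! ### The statistics in terms of the path -/

/-- In a `321`-avoiding permutation the left-right maxima are the weak excedances. -/
theorem isLrm_iff {n : ℕ} {σ : Equiv.Perm (Fin n)} (hσ : σ ∈ Av n pattern321) (i : Fin n) :
    (∀ j, j ≤ i → σ j ≤ σ i) ↔ i ≤ σ i := by
  constructor
  · intro h
    by_contra! hi
    obtain ⟨l, hl, hl'⟩ := exists_upward_of_downward le_rfl (Fin.lt_def.1 hi)
    have := h l (by omega)
    omega
  · intro hi j hj
    by_contra! hji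
    have hne : j ≠ i := by rintro rfl; exact lt_irrefl _ hji
    -- Some value jumps downwards over `σ i`: it completes a pattern `321` that begins at `j`, `i`.
    obtain ⟨l, hl, hl'⟩ : ∃ l : Fin n, (σ i).val ≤ l.val ∧ (σ l).val < (σ i).val := by
      rcases hi.lt_or_eq with h | h
      · exact exists_downward_of_upward (Fin.lt_def.1 h) le_rfl
      · exact exists_downward_of_upward (i := j) (by omega) (by omega)
    have hli : l ≠ i := by rintro rfl; omega
    have := mem_Av_pattern321.1 hσ j i l (by omega) (by omega) hji
    omega

theorem strictMonoOn_exc {n : ℕ} {σ : Equiv.Perm (Fin n)} (hσ : σ ∈ Av n pattern321) :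
    StrictMonoOn σ {i | i ≤ σ i} := by
  intro i _ j hj hij
  exact lt_of_le_of_ne ((isLrm_iff hσ j).2 hj i hij.le) (σ.injective.ne hij.ne)

theorem strictMonoOn_not_exc {n : ℕ} {σ : Equiv.Perm (Fin n)} (hσ : σ ∈ Av n pattern321) :
    StrictMonoOn σ {i | i ≤ σ i}ᶜ := by
  intro i hi j _ hij
  simp only [Set.mem_compl_iff, Set.mem_ofPred_eq, not_le] at hi
  obtain ⟨l, hl, hl'⟩ := exists_upward_of_downward le_rfl (Fin.lt_def.1 hi)
  exact lt_of_le_of_ne (mem_Av_pattern321.1 hσ l i j (by omega) hij (by omega))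
    (σ.injective.ne hij.ne)

theorem lrm_eq {n : ℕ} {σ : Equiv.Perm (Fin n)} (hσ : σ ∈ Av n pattern321) :
    lrm σ = (Finset.univ.filter fun i => (word σ i).1 = true).card := by
  rw [lrm, Lrm, Finset.card_image_of_injective _ σ.injective]
  simp only [isLrm_iff hσ, word, decide_eq_true_eq]

theorem fix_eq {n : ℕ} {σ : Equiv.Perm (Fin n)} (hσ : σ ∈ Av n pattern321) :
    fix σ = (Finset.univ.filter fun k : Fin n =>
      word σ k = (true, true) ∧ height σ k = 0).card := by
  rw [fix]
  congr 1
  ext k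
  simp only [Finset.mem_filter, Finset.mem_univ, true_and, word, Prod.mk.injEq, decide_eq_true_eq]
  constructor
  · intro hk
    have hk' : σ.symm k = k := by rw [Equiv.symm_apply_eq, hk]
    refine ⟨⟨hk.ge, hk'.le⟩, ?_⟩
    by_contra h0
    -- A value jumping upwards over `k`, the entry `k` and a value jumping downwards over `k` form
    -- a pattern `321`.
    obtain ⟨l, hl⟩ := Finset.card_pos.1 (Nat.pos_of_ne_zero h0)
    simp only [Finset.mem_filter, Finset.mem_univ, true_and] at hl
    obtain ⟨m, hm, hm'⟩ := exists_downward_of_upward hl.1 hl.2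
    have hlk : σ l ≠ σ k := σ.injective.ne (by rintro rfl; omega)
    have hmk : m ≠ k := by rintro rfl; omega
    have := mem_Av_pattern321.1 hσ l k m (by omega) (by omega) (by omega)
    omega
  · rintro ⟨⟨_, h2⟩, h0⟩
    rw [height, Finset.card_eq_zero] at h0
    rcases h2.lt_or_eq with h | h
    · have : σ.symm k ∈ Finset.univ.filter fun i : Fin n => i.val < k.val ∧ k.val ≤ (σ i).val := by
        simpa using h
      rw [h0] at this
      exact absurd this (Finset.notMem_empty _)
    · exact ((Equiv.symm_apply_eq σ).1 h).symm

/-- The larger entry of an inversion of a `321`-avoiding permutation is a left-right maximum, and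
the left-right maximum at position `i` is the larger entry of `σ i - i` inversions. -/
theorem card_inv_at {n : ℕ} {σ : Equiv.Perm (Fin n)} (hσ : σ ∈ Av n pattern321) (i : Fin n) :
    (Finset.univ.filter fun j => i < j ∧ σ j < σ i).card = (σ i).val - i.val := by
  rcases le_or_gt i (σ i) with hi | hi
  · have h1 := card_filter_apply σ fun j => j < σ i
    have h2 : (Finset.univ.filter fun j => σ j < σ i) =
        (Finset.univ.filter fun j => j < i) ∪ Finset.univ.filter fun j => i < j ∧ σ j < σ i := by
      ext j
      simp only [Finset.mem_filter, Finset.mem_univ, true_and, Finset.mem_union]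
      constructor
      · intro h
        have hne : j ≠ i := by rintro rfl; exact lt_irrefl _ h
        rcases lt_or_gt_of_ne hne with h' | h'
        · exact Or.inl h'
        · exact Or.inr ⟨h', h⟩
      · rintro (h | h)
        · exact lt_of_le_of_ne ((isLrm_iff hσ i).2 hi j h.le) (σ.injective.ne h.ne)
        · exact h.2
    rw [h2, Finset.card_union_of_disjoint] at h1
    · simp only [Finset.filter_gt_eq_Iio, Fin.card_Iio] at h1
      omega
    · rw [Finset.disjoint_filter]
      intro j _ h h'
      omega
  · rw [Nat.sub_eq_zero_of_le (Fin.le_def.1 hi.le), Finset.card_eq_zero, Finset.filter_eq_empty_iff]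
    rintro j - ⟨hij, hj⟩
    obtain ⟨l, hl, hl'⟩ := exists_upward_of_downward le_rfl (Fin.lt_def.1 hi)
    have := mem_Av_pattern321.1 hσ l i j (by omega) hij (by omega)
    omega

theorem inv_eq {n : ℕ} {σ : Equiv.Perm (Fin n)} (hσ : σ ∈ Av n pattern321) :
    inv σ = ∑ k : Fin n, height σ (k + 1) := by
  have h1 : inv σ = ∑ i : Fin n, ((σ i).val - i.val) := by
    simp only [inv, Finset.card_filter, Fintype.sum_prod_type]
    refine Finset.sum_congr rfl fun i _ => ?_
    rw [← card_inv_at hσ, Finset.card_filter]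
  simp only [h1, height, Finset.card_filter]
  rw [Finset.sum_comm]
  refine Finset.sum_congr rfl fun i _ => ?_
  rw [← Fin.card_Ico, ← Finset.card_filter]
  congr 1
  ext k
  simp only [Finset.mem_Ico, Finset.mem_filter, Finset.mem_univ, true_and]
  omega

/-- The path of a `321`-avoiding permutation uses no forbidden step, as `σ k < k` makes some earlier
value exceed `k`; its weight is the monomial of the permutation. -/
theorem pathWeight_word {R : Type*} [CommRing R] (q t x : R) {n : ℕ} {σ : Equiv.Perm (Fin n)}
    (hσ : σ ∈ Av n pattern321) :
    pathWeight q t x n 0 (word σ) = q ^ inv σ * t ^ lrm σ * x ^ fix σ := by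
  have h0 : height σ 0 = 0 := by simp [height]
  have hn : height σ n = 0 := by
    rw [height, Finset.card_eq_zero, Finset.filter_eq_empty_iff]
    rintro i - ⟨_, h⟩
    omega
  have hstep : ∀ k : Fin n, stepWeight q t x (height σ k) (word σ k) =
      q ^ height σ (k + 1) * (if (word σ k).1 = true then t else 1) *
        (if word σ k = (true, true) ∧ height σ k = 0 then x else 1) := by
    intro k
    rw [stepWeight, if_neg, height_succ]
    rintro ⟨h1, h2⟩
    have h3 : σ k < k := by simpa [word] using h1
    exact (height_pos_of_downward le_rfl (Fin.lt_def.1 h3)).ne' h2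
  rw [← h0, pathWeight_eq_prod q t x n (height σ) (word σ) (height_succ σ), if_pos hn, mul_one,
    Finset.prod_congr rfl fun k _ => hstep k, Finset.prod_mul_distrib, Finset.prod_mul_distrib,
    Finset.prod_pow_eq_pow_sum, inv_eq hσ, lrm_eq hσ, fix_eq hσ]
  simp only [Finset.prod_ite, Finset.prod_const, one_pow, mul_one]

/-! ### The path determines the permutation -/

theorem _root_.StrictMonoOn.eqOn_of_image_eq {α β : Type*} [LinearOrder α] [WellFoundedLT α]
    [PartialOrder β] {f g : α → β} {s : Set α} (hf : StrictMonoOn f s) (hg : StrictMonoOn g s)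
    (h : f '' s = g '' s) : Set.EqOn f g s := by
  have := (StrictMono.range_inj (f := s.domRestrict f) (g := s.domRestrict g)
    (fun a b hab => hf a.2 b.2 hab) (fun a b hab => hg a.2 b.2 hab)).1
    (by rwa [Set.range_domRestrict, Set.range_domRestrict])
  exact fun a ha => congrFun this ⟨a, ha⟩

theorem image_exc {n : ℕ} (σ : Equiv.Perm (Fin n)) :
    σ '' {i | i ≤ σ i} = {k | (word σ k).2 = true} := by
  ext k
  simp [Equiv.image_eq_preimage_symm, word]

theorem word_injOn {n : ℕ} :
    Set.InjOn word (Av n pattern321 : Set (Equiv.Perm (Fin n))) := by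
  intro σ hσ τ hτ h
  have hP : {i | i ≤ σ i} = {i | i ≤ τ i} := by
    ext i
    simpa [word] using congrArg Prod.fst (congrFun h i)
  have hV : σ '' {i | i ≤ σ i} = τ '' {i | i ≤ σ i} := by
    rw [image_exc, h, hP, image_exc]
  have h1 := (strictMonoOn_exc hσ).eqOn_of_image_eq (hP ▸ strictMonoOn_exc hτ) hV
  have h2 := (strictMonoOn_not_exc hσ).eqOn_of_image_eq (hP ▸ strictMonoOn_not_exc hτ)
    (by rw [Set.image_compl_eq σ.bijective, Set.image_compl_eq τ.bijective, hV])
  ext i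
  by_cases hi : i ∈ {i | i ≤ σ i}
  · rw [h1 hi]
  · rw [h2 hi]

/-! ### Every path of nonzero weight occurs -/

/-- Two sets of the same size are matched by a permutation that is increasing on the first set and
on its complement. -/
theorem exists_perm_strictMonoOn {n : ℕ} (P V : Finset (Fin n)) (h : P.card = V.card) :
    ∃ σ : Equiv.Perm (Fin n), (∀ i, σ i ∈ V ↔ i ∈ P) ∧ StrictMonoOn σ (P : Set (Fin n)) ∧
      StrictMonoOn σ (P : Set (Fin n))ᶜ := by
  have hc : Pᶜ.card = Vᶜ.card := by rw [Finset.card_compl, Finset.card_compl, h]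
  let e : P ≃o V := (P.orderIsoOfFin h).symm.trans (V.orderIsoOfFin rfl)
  let f : (Pᶜ : Finset (Fin n)) ≃o (Vᶜ : Finset (Fin n)) :=
    (Pᶜ.orderIsoOfFin hc).symm.trans (Vᶜ.orderIsoOfFin rfl)
  let g : Fin n → Fin n := fun i =>
    if hi : i ∈ P then e ⟨i, hi⟩ else f ⟨i, Finset.mem_compl.2 hi⟩
  have g1 : ∀ i (hi : i ∈ P), g i = e ⟨i, hi⟩ := fun i hi => dif_pos hi
  have g2 : ∀ i (hi : i ∉ P), g i = f ⟨i, Finset.mem_compl.2 hi⟩ := fun i hi => dif_neg hi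
  have gV : ∀ i, g i ∈ V ↔ i ∈ P := by
    intro i
    by_cases hi : i ∈ P
    · rw [g1 i hi]
      simp [hi]
    · rw [g2 i hi]
      simpa [hi] using Finset.mem_compl.1 (f ⟨i, Finset.mem_compl.2 hi⟩).2
  have hinj : Function.Injective g := by
    intro i j hij
    have hij' : i ∈ P ↔ j ∈ P := by rw [← gV, hij, gV]
    by_cases hi : i ∈ P
    · rw [g1 i hi, g1 j (hij'.1 hi), Subtype.coe_inj, e.injective.eq_iff] at hij
      exact congrArg Subtype.val hij
    · rw [g2 i hi, g2 j (hij'.not.1 hi), Subtype.coe_inj, f.injective.eq_iff] at hij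
      exact congrArg Subtype.val hij
  refine ⟨Equiv.ofBijective g (Finite.injective_iff_bijective.1 hinj), gV, ?_, ?_⟩
  · intro i hi j hj hij
    simp only [Equiv.ofBijective_apply]
    rw [g1 i hi, g1 j hj, Subtype.coe_lt_coe, e.lt_iff_lt]
    exact hij
  · intro i hi j hj hij
    simp only [Equiv.ofBijective_apply]
    rw [g2 i hi, g2 j hj, Subtype.coe_lt_coe, f.lt_iff_lt]
    exact hij

theorem mem_Av_of_strictMonoOn {n : ℕ} {σ : Equiv.Perm (Fin n)} {s : Set (Fin n)}
    (h1 : StrictMonoOn σ s) (h2 : StrictMonoOn σ sᶜ) : σ ∈ Av n pattern321 := by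
  rw [mem_Av_pattern321]
  intro i j k hij hjk hji
  by_contra! hkj
  -- Two of the three entries lie on the same side of the partition into `s` and its complement.
  have key : ∀ a b, a < b → σ b < σ a → (a ∈ s ↔ b ∉ s) := by
    intro a b hab hba
    by_cases ha : a ∈ s <;> by_cases hb : b ∈ s
    · exact absurd (h1 ha hb hab) hba.asymm
    · simp [ha, hb]
    · simp [ha, hb]
    · exact absurd (h2 ha hb hab) hba.asymm
  have := key i j hij hji
  have := key j k hjk hkj
  have := key i k (hij.trans hjk) (hkj.trans hji)
  tauto

/-- An increasing bijection preserves ranks. -/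
theorem card_filter_lt_apply {n : ℕ} {σ : Equiv.Perm (Fin n)} {P V : Finset (Fin n)}
    (hV : ∀ i, σ i ∈ V ↔ i ∈ P) (hσ : StrictMonoOn σ (P : Set (Fin n))) {i : Fin n} (hi : i ∈ P) :
    (V.filter fun j => j < σ i).card = (P.filter fun j => j < i).card := by
  symm
  refine Finset.card_bij (fun j _ => σ j) ?_ (fun _ _ _ _ h => σ.injective h) ?_
  · intro j hj
    rw [Finset.mem_filter] at hj ⊢
    exact ⟨(hV j).2 hj.1, hσ hj.1 hi hj.2⟩
  · intro k hk
    rw [Finset.mem_filter] at hk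
    have hk' : σ.symm k ∈ P := by rw [← hV, Equiv.apply_symm_apply]; exact hk.1
    refine ⟨σ.symm k, Finset.mem_filter.2 ⟨hk', ?_⟩, Equiv.apply_symm_apply _ _⟩
    rw [← hσ.lt_iff_lt hk' hi, Equiv.apply_symm_apply]
    exact hk.2

/-- A word is the word of a `321`-avoiding permutation if its heights `c` end at `0` and every step
from height `0` gains a unit. The second condition already keeps the path from going below `0`, so
the truncated subtraction in `nextHeight` never truncates. -/
theorem exists_word_eq {n : ℕ} (w : Fin n → Bool × Bool) (c : ℕ → ℕ) (hc0 : c 0 = 0)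
    (hc : ∀ k : Fin n, c (k + 1) = nextHeight (c k) (w k)) (hcn : c n = 0)
    (hw : ∀ k : Fin n, ¬((w k).1 = false ∧ c k = 0)) :
    ∃ σ ∈ Av n pattern321, word σ = w := by
  classical
  set P := Finset.univ.filter fun k => (w k).1 = true with hP
  set V := Finset.univ.filter fun k => (w k).2 = true with hV
  -- The height counts the units gained minus the units lost so far.
  have hcount : ∀ k ≤ n, c k + (V.filter fun j => j.val < k).card =
      (P.filter fun j => j.val < k).card := by
    intro k
    induction k with
    | zero => simp [hc0]
    | succ k ih =>
      intro hk
      have ih := ih (by omega)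
      have hck := hc ⟨k, hk⟩
      have hwk := hw ⟨k, hk⟩
      have hadd : ∀ S : Finset (Fin n), (S.filter fun j => j.val < k + 1).card =
          (S.filter fun j => j.val < k).card + if (⟨k, hk⟩ : Fin n) ∈ S then 1 else 0 := by
        intro S
        have hS : (S.filter fun j => j.val < k + 1) =
            (S.filter fun j => j.val < k) ∪ S.filter fun j => j = ⟨k, hk⟩ := by
          rw [← Finset.filter_or]
          refine Finset.filter_congr fun j _ => ?_
          rw [Fin.ext_iff]
          exact Nat.lt_succ_iff_lt_or_eq
        rw [hS, Finset.card_union_of_disjoint, Finset.filter_eq']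
        · split_ifs <;> simp
        · rw [Finset.disjoint_filter]
          rintro j _ h rfl
          exact lt_irrefl _ h
      rw [hadd, hadd]
      have hPk : (⟨k, hk⟩ : Fin n) ∈ P ↔ (w ⟨k, hk⟩).1 = true := by simp [hP]
      have hVk : (⟨k, hk⟩ : Fin n) ∈ V ↔ (w ⟨k, hk⟩).2 = true := by simp [hV]
      simp only [hPk, hVk]
      simp only [nextHeight] at hck
      cases h1 : (w ⟨k, hk⟩).1 <;> cases h2 : (w ⟨k, hk⟩).2 <;>
        simp [h1, h2] at hck hwk ⊢ <;> omega
  have hle : ∀ i : Fin n, (V.filter fun j => j < i).card ≤ (P.filter fun j => j < i).card :=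
    fun i => (Nat.le_add_left _ _).trans (hcount i i.2.le).le
  have hlt : ∀ i ∉ P, (V.filter fun j => j < i).card < (P.filter fun j => j < i).card := by
    intro i hi
    have h1 := hcount i i.2.le
    have h2 := hw i
    have h3 : (w i).1 = false := by simpa [hP] using hi
    have h4 : c i ≠ 0 := fun h => h2 ⟨h3, h⟩
    simp only [Fin.lt_def]
    omega
  have hcard : P.card = V.card := by
    have := hcount n le_rfl
    simpa [hcn] using this.symm
  obtain ⟨σ, hσV, h1, h2⟩ := exists_perm_strictMonoOn P V hcard
  have hσV' : ∀ i, σ i ∈ Vᶜ ↔ i ∈ Pᶜ := by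
    intro i
    rw [Finset.mem_compl, Finset.mem_compl, hσV]
  have hcompl : ∀ (S : Finset (Fin n)) (i : Fin n), (S.filter fun j => j < i).card +
      (Sᶜ.filter fun j => j < i).card = i.val := by
    intro S i
    rw [← Finset.card_union_of_disjoint
      (Finset.disjoint_filter_filter disjoint_compl_right), ← Finset.filter_union,
      Finset.union_compl, Finset.filter_gt_eq_Iio, Fin.card_Iio]
  have hexc : ∀ i, i ≤ σ i ↔ i ∈ P := by
    intro i
    constructor
    · intro h
      by_contra hi
      -- The rank of `σ i` among the unmarked values is that of `i` among the unmarked positions,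
      -- but fewer unmarked positions than unmarked values lie before `i`.
      have e1 := card_filter_lt_apply hσV' (by simpa using h2) (Finset.mem_compl.2 hi)
      have e2 : (Vᶜ.filter fun j => j < i).card ≤ (Vᶜ.filter fun j => j < σ i).card :=
        Finset.card_le_card (Finset.monotone_filter_right _ fun j _ hj => hj.trans_le h)
      have := hcompl P i
      have := hcompl V i
      have := hlt i hi
      omega
    · intro hi
      by_contra! h
      -- The marked value `σ i` lies before `i`, so more marked values than marked positions do.
      have e1 := card_filter_lt_apply hσV h1 hi
      have e2 : (V.filter fun j => j < σ i).card < (V.filter fun j => j < i).card := by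
        refine Finset.card_lt_card (Finset.ssubset_iff_of_subset ?_ |>.2 ⟨σ i, ?_, ?_⟩)
        · exact Finset.monotone_filter_right _ fun j _ hj => hj.trans h
        · exact Finset.mem_filter.2 ⟨(hσV i).2 hi, h⟩
        · simp
      have := hle i
      omega
  refine ⟨σ, mem_Av_of_strictMonoOn h1 h2, ?_⟩
  ext k
  · simp [word, hexc, hP]
  · have h3 : σ.symm k ≤ k ↔ k ∈ V := by
      rw [← σ.apply_symm_apply k, hσV, ← hexc]
      simp
    simp [word, h3, hV]

/-- The heights along the path that starts at height `0` and follows the word `w`. -/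
def runHeight {n : ℕ} (w : Fin n → Bool × Bool) : ℕ → ℕ
  | 0 => 0
  | k + 1 => if h : k < n then nextHeight (runHeight w k) (w ⟨k, h⟩) else runHeight w k

theorem exists_word_eq_of_pathWeight_ne_zero {R : Type*} [CommRing R] {q t x : R} {n : ℕ}
    {w : Fin n → Bool × Bool} (hw : pathWeight q t x n 0 w ≠ 0) :
    ∃ σ ∈ Av n pattern321, word σ = w := by
  have hc : ∀ k : Fin n, runHeight w (k + 1) = nextHeight (runHeight w k) (w k) := by
    intro k
    rw [runHeight, dif_pos k.2]
  have h := pathWeight_eq_prod q t x n (runHeight w) w hc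
  rw [runHeight] at h
  rw [h] at hw
  refine exists_word_eq w (runHeight w) rfl hc ?_ ?_
  · by_contra h0
    exact hw (by rw [if_neg h0, mul_zero])
  · intro k hk
    refine hw ?_
    rw [Finset.prod_eq_zero (Finset.mem_univ k), zero_mul]
    rw [stepWeight, if_pos hk]

theorem I_eq_pathSum {R : Type*} [CommRing R] (q t x : R) (n : ℕ) :
    I q t x n = pathSum q t x n 0 := by
  classical
  rw [I, pathSum, ← Finset.sum_subset (Finset.subset_univ ((Av n pattern321).image word)),
    Finset.sum_image word_injOn]
  · exact Finset.sum_congr rfl fun σ hσ => (pathWeight_word q t x hσ).symm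
  · intro w _ hw
    by_contra h
    exact hw (Finset.mem_image.2 (exists_word_eq_of_pathWeight_ne_zero h))

end PermStat

/-! ### The continued fraction of the generating function -/

theorem mainTheorem3 {R : Type*} [CommRing R] (q t x : R) :
    JFraction.HasExpansion (PermStat.genFun q t x)
      (fun h => if h = 0 then t * x else (1 + t) * q ^ h)
      (fun h => t * q ^ (2 * h - 1)) := by
  simpa only [PermStat.genFun, PermStat.I_eq_pathSum] using PermStat.hasExpansion_pathSum q t x
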